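/- A coarse structure on a set $X$ is a family $\mathcal C$ of subsets of $X\times X$ (the controlled sets) that contains the diagonal and is closed under subsets, inverses, finite unions and products $T_1\circ T_2=\{(x,y): \exists z,\ (x,z)\in T_1,\ (z,y)\in T_2\}$; connectivity is not assumed. It is countably generated if it is the smallest coarse structure containing some countable family of controlled sets. For $T\subset X\times X$ and $Y\subset X$ write $T[Y]=\{x\in X : \exists y\in Y,\ (x,y)\in T\}$ and $T[x]=T[\{x\}]$; $Y$ is $T$-bounded if $Y\subset T[x]$ for some $x\in X$. The coarse space $(X,\mathcal C)$ is uniformly locally finite if $\sup_{x\in X}\sharp T[x]<\infty$ for every $T\in\mathcal C$. A uniformly locally finite coarse space $(X,\mathcal C)$ has property A if for every $\epsilon>0$ and every $T\in\mathcal C$ there are $F\in\mathcal C$ and $A\subset F\times\mathbb N$ such that, with $A_x=\{(y,n)\in X\times\mathbb N : (x,y,n)\in A\}$: every $A_x$ is finite; $(x,x,1)\in A$ for every $x\in X$; and $\sharp(A_x\triangle A_y)<\epsilon\,\sharp(A_x\cap A_y)$ for every $(x,y)\in T$. Given mutually disjoint non-empty finite subsets $X_m$ $(m\ge 1)$ of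 $X$, equip $\bigsqcup_m X_m$ with the coarse structure $\{T\cap\bigsqcup_m X_m^2 : T\in\mathcal C\}$, and let $w_m$ be a finite measure on $X_m$ with support $X_m$. The resulting weighted box subspace $\bigsqcup_m (X_m,w_m)$ is a weighted weak expander sequence if there are a controlled set $T$ of $\bigsqcup_m X_m$ and $c>0$ such that for every controlled set $F$ of $\bigsqcup_m X_m$ $$\liminf_{m\to\infty}\ \min\left\{\frac{w_m(T[Y])}{w_m(Y)} : \emptyset\ne Y\subset X_m,\ Y \text{ is } F\text{-bounded}\right\}>1+c,$$ where $\min\emptyset=\infty$. Theorem. Let $(X,\mathcal C)$ be a countably generated, uniformly locally finite coarse space. Then $X$ does not have property A if and only if there exist mutually disjoint non-empty finite subsets $X_1,X_2,\dots$ of $X$ and finite measures $w_m$ on $X_m$ with support $X_m$ such that the weighted box subspace $\bigsqcup_{m}(X_m,w_m)$ is a weighted weak expander sequence. -/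

import Mathlib

open scoped ENNReal NNReal symmDiff

/-- A coarse structure on `X`: a family of subsets of `X × X` (the controlled sets) containing the
diagonal and closed under subsets, inverses, products and finite unions.
No connectivity is required. The product is
`R.comp S = {(x, y) | ∃ z, (x, z) ∈ R ∧ (z, y) ∈ S}`. -/
structure CoarseStructure (X : Type*) where
  controlled : Set (SetRel X X)
  diag_mem : SetRel.id ∈ controlled
  subset_mem : ∀ {S T : SetRel X X}, T ∈ controlled → S ⊆ T → S ∈ controlled
  inv_mem : ∀ {T : SetRel X X}, T ∈ controlled → T.inv ∈ controlled
  comp_mem : ∀ {S T : SetRel X X}, S ∈ controlled → T ∈ controlled → S.comp T ∈ controlled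
  union_mem : ∀ {S T : SetRel X X}, S ∈ controlled → T ∈ controlled → S ∪ T ∈ controlled

/-- `T[Y] = {x | ∃ y ∈ Y, (x, y) ∈ T}`. -/
def relNhd {X : Type*} (T : SetRel X X) (Y : Set X) : Set X :=
  {x | ∃ y ∈ Y, (x, y) ∈ T}

/-- `Y` is `T`-bounded if `Y ⊆ T[x]` for some point `x`. -/
def IsRelBounded {X : Type*} (T : SetRel X X) (Y : Set X) : Prop :=
  ∃ x : X, Y ⊆ relNhd T {x}

namespace CoarseStructure

variable {X : Type*}

/-- Some countable family `𝒯` of controlled sets generates the coarse structure: `C` is the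
smallest coarse structure containing `𝒯`. -/
def CountablyGenerated (C : CoarseStructure X) : Prop :=
  ∃ 𝒯 : Set (SetRel X X), 𝒯.Countable ∧ 𝒯 ⊆ C.controlled ∧
    ∀ D : CoarseStructure X, 𝒯 ⊆ D.controlled → C.controlled ⊆ D.controlled

/-- For every controlled set `T`, the cardinalities of the sets `T[x]` are uniformly bounded. -/
def UniformlyLocallyFinite (C : CoarseStructure X) : Prop :=
  ∀ T ∈ C.controlled, ∃ N : ℕ, ∀ x : X, (relNhd T {x}).encard ≤ N

/-- The slice `A_x = {(y, n) | (x, y, n) ∈ A}`. -/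
def slice (A : Set ((X × X) × ℕ)) (x : X) : Set (X × ℕ) :=
  {p | ((x, p.1), p.2) ∈ A}

/-- Yu's property A. -/
def PropertyA (C : CoarseStructure X) : Prop :=
  ∀ ε : ℝ, 0 < ε → ∀ T ∈ C.controlled,
    ∃ F ∈ C.controlled, ∃ A : Set ((X × X) × ℕ), A ⊆ F ×ˢ Set.univ ∧
      (∀ x, (slice A x).Finite) ∧
      (∀ x, ((x, x), 1) ∈ A) ∧
      ∀ x y, (x, y) ∈ T →
        ((slice A x ∆ slice A y).ncard : ℝ) < ε * ((slice A x ∩ slice A y).ncard : ℝ)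

/-- The box subspace of `(X, C)` given by mutually disjoint subsets `E m`: the set `⋃ m, E m`
with the controlled sets `T ∩ ⋃ m, E m × E m`, where `T ∈ C`. -/
def boxSubspace (C : CoarseStructure X) (E : ℕ → Set X)
    (hE : Pairwise (Function.onFun Disjoint E)) : CoarseStructure (⋃ m, E m : Set X) where
  controlled := {S | ∃ T ∈ C.controlled,
    S = {p | ((p.1 : X), (p.2 : X)) ∈ T ∧ ∃ m, (p.1 : X) ∈ E m ∧ (p.2 : X) ∈ E m}}
  diag_mem := by
    refine ⟨SetRel.id, C.diag_mem, ?_⟩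
    ext ⟨x, y⟩
    constructor
    · intro h
      obtain rfl : x = y := h
      obtain ⟨m, hm⟩ := Set.mem_iUnion.1 x.2
      exact ⟨rfl, m, hm, hm⟩
    · rintro ⟨h, -⟩
      exact Subtype.ext h
  subset_mem := by
    rintro S _ ⟨T, hT, rfl⟩ hST
    refine ⟨(fun p : (⋃ m, E m : Set X) × (⋃ m, E m : Set X) => ((p.1 : X), (p.2 : X))) '' S,
      C.subset_mem hT ?_, ?_⟩
    · rintro _ ⟨p, hp, rfl⟩
      exact (hST hp).1
    · ext ⟨x, y⟩
      constructor
      · intro h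
        exact ⟨⟨(x, y), h, rfl⟩, (hST h).2⟩
      · rintro ⟨⟨⟨x', y'⟩, h, he⟩, -⟩
        obtain ⟨h1, h2⟩ := Prod.mk.inj he
        obtain rfl := Subtype.ext h1
        obtain rfl := Subtype.ext h2
        exact h
  inv_mem := by
    rintro _ ⟨T, hT, rfl⟩
    refine ⟨T.inv, C.inv_mem hT, ?_⟩
    ext ⟨x, y⟩
    constructor
    · rintro ⟨h, m, h1, h2⟩
      exact ⟨h, m, h2, h1⟩
    · rintro ⟨h, m, h1, h2⟩
      exact ⟨h, m, h2, h1⟩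
  comp_mem := by
    rintro _ _ ⟨S, hS, rfl⟩ ⟨T, hT, rfl⟩
    refine ⟨S.comp T ∩ {p | ∃ m, ∃ z ∈ E m, p.1 ∈ E m ∧ p.2 ∈ E m ∧ (p.1, z) ∈ S ∧ (z, p.2) ∈ T},
      C.subset_mem (C.comp_mem hS hT) Set.inter_subset_left, ?_⟩
    ext ⟨x, y⟩
    constructor
    · rintro ⟨z, ⟨h1, m, hxm, hzm⟩, ⟨h2, n, hzn, hyn⟩⟩
      obtain rfl : m = n := by
        by_contra hmn
        exact Set.disjoint_left.1 (hE hmn) hzm hzn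
      exact ⟨⟨⟨z, h1, h2⟩, m, z, hzm, hxm, hyn, h1, h2⟩, m, hxm, hyn⟩
    · rintro ⟨⟨-, m, z, hz, hx, hy, h1, h2⟩, -⟩
      exact ⟨⟨z, Set.mem_iUnion.2 ⟨m, hz⟩⟩, ⟨h1, m, hx, hz⟩, ⟨h2, m, hz, hy⟩⟩
  union_mem := by
    rintro _ _ ⟨S, hS, rfl⟩ ⟨T, hT, rfl⟩
    refine ⟨S ∪ T, C.union_mem hS hT, ?_⟩
    ext ⟨x, y⟩
    constructor
    · rintro (⟨h, hm⟩ | ⟨h, hm⟩)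
      · exact ⟨Or.inl h, hm⟩
      · exact ⟨Or.inr h, hm⟩
    · rintro ⟨h | h, hm⟩
      · exact Or.inl ⟨h, hm⟩
      · exact Or.inr ⟨h, hm⟩

/-- `(X, C)` is a box space with the decomposition `X = ⨆ m, E m` into finite non-empty blocks:
no controlled set connects different blocks. -/
structure IsBoxSpace (C : CoarseStructure X) (E : ℕ → Set X) : Prop where
  uniformlyLocallyFinite : C.UniformlyLocallyFinite
  disjoint : Pairwise (Function.onFun Disjoint E)
  iUnion_eq : ⋃ m, E m = Set.univ
  finite : ∀ m, (E m).Finite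
  nonempty : ∀ m, (E m).Nonempty
  controlled_subset : ∀ T ∈ C.controlled, T ⊆ ⋃ m, E m ×ˢ E m

end CoarseStructure

/-- Measures on `X` for which every subset is measurable. -/
abbrev DiscreteMeasure (X : Type*) := @MeasureTheory.Measure X ⊤

namespace CoarseStructure

variable {X : Type*}

/-- A weighted box space: a box space together with, for each `m`, a finite measure `w m` on the
block `E m` (regarded as a measure on `X` vanishing off `E m`) whose support is all of `E m`. -/
structure IsWeightedBoxSpace (C : CoarseStructure X) (E : ℕ → Set X)
    (w : ℕ → DiscreteMeasure X) : Prop where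
  isBoxSpace : C.IsBoxSpace E
  finite_measure : ∀ m, w m Set.univ < ∞
  measure_compl : ∀ m, w m (E m)ᶜ = 0
  support : ∀ m, ∀ x ∈ E m, w m {x} ≠ 0

/-- A weighted box space is a weighted weak expander sequence if for some controlled set `T` and
some `c > 0`, every controlled set `F` satisfies
`liminf_m min {w_m(T[Y]) / w_m(Y) | ∅ ≠ Y ⊆ E m, Y is F-bounded} > 1 + c`.
The minimum is taken in `[0, ∞]`; it is `∞` if there is no such `Y`. -/
structure IsWeightedWeakExpander (C : CoarseStructure X) (E : ℕ → Set X)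
    (w : ℕ → DiscreteMeasure X) : Prop where
  isWeightedBoxSpace : C.IsWeightedBoxSpace E w
  expand : ∃ T ∈ C.controlled, ∃ c : ℝ≥0, 0 < c ∧ ∀ F ∈ C.controlled,
    1 + (c : ℝ≥0∞) < Filter.liminf
      (fun m => ⨅ Y ∈ {Y : Set X | Y.Nonempty ∧ Y ⊆ E m ∧ IsRelBounded F Y},
        w m (relNhd T Y) / w m Y) Filter.atTop

end CoarseStructure

namespace CoarseStructure

variable {X : Type*}

/-! ### Cofinal sequences and local finiteness -/

/-- Each stage adjoins products and inverses of the previous one and one more generator, so the sets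
contained in some stage form a coarse structure containing all generators; minimality finishes. -/
theorem CountablyGenerated.exists_monotone_cofinal {C : CoarseStructure X}
    (h : C.CountablyGenerated) :
    ∃ F : ℕ → SetRel X X, Monotone F ∧ (∀ n, F n ∈ C.controlled) ∧
      ∀ T ∈ C.controlled, ∃ n, T ⊆ F n := by
  obtain ⟨𝒯, hc, hsub, hmin⟩ := h
  -- Inserting the diagonal makes the family nonempty, hence the range of a sequence.
  obtain ⟨g, hg⟩ := (hc.insert SetRel.id).exists_eq_range (Set.insert_nonempty _ _)
  have hgC : ∀ n, g n ∈ C.controlled := by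
    intro n
    have : g n ∈ insert SetRel.id 𝒯 := hg ▸ Set.mem_range_self n
    rcases this with h | h
    · rw [h]; exact C.diag_mem
    · exact hsub h
  let F : ℕ → SetRel X X := fun n =>
    Nat.rec SetRel.id (fun n R => ((R ∪ R.comp R) ∪ (R.inv ∪ g n) : Set (X × X))) n
  have hF : ∀ n, F (n + 1) = ((F n ∪ (F n).comp (F n)) ∪ ((F n).inv ∪ g n) : Set (X × X)) :=
    fun n => rfl
  have hmono : Monotone F := by
    refine monotone_nat_of_le_succ fun n => ?_
    rw [hF]
    exact fun p hp => Or.inl (Or.inl hp)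
  have hFC : ∀ n, F n ∈ C.controlled := by
    intro n
    induction n with
    | zero => exact C.diag_mem
    | succ n ih =>
      rw [hF]
      exact C.union_mem (C.union_mem ih (C.comp_mem ih ih)) (C.union_mem (C.inv_mem ih) (hgC n))
  let D : CoarseStructure X :=
    { controlled := {T | ∃ n, T ⊆ F n}
      diag_mem := ⟨0, subset_rfl⟩
      subset_mem := fun ⟨n, hn⟩ h => ⟨n, h.trans hn⟩
      inv_mem := by
        rintro T ⟨n, hn⟩
        refine ⟨n + 1, ?_⟩
        rw [hF]
        exact fun p hp => Or.inr (Or.inl (hn hp))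
      comp_mem := by
        rintro S T ⟨n, hn⟩ ⟨k, hk⟩
        refine ⟨max n k + 1, ?_⟩
        rw [hF]
        rintro ⟨x, y⟩ ⟨z, h1, h2⟩
        exact Or.inl (Or.inr ⟨z, hmono (le_max_left n k) (hn h1),
          hmono (le_max_right n k) (hk h2)⟩)
      union_mem := by
        rintro S T ⟨n, hn⟩ ⟨k, hk⟩
        refine ⟨max n k, ?_⟩
        rintro p (hp | hp)
        · exact hmono (le_max_left n k) (hn hp)
        · exact hmono (le_max_right n k) (hk hp) }
  refine ⟨F, hmono, hFC, fun T hT => hmin D ?_ hT⟩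
  intro R hR
  have : R ∈ Set.range g := hg ▸ Set.mem_insert_of_mem _ hR
  obtain ⟨n, rfl⟩ := this
  refine ⟨n + 1, ?_⟩
  rw [hF]
  exact fun p hp => Or.inr (Or.inr hp)

theorem UniformlyLocallyFinite.encard_right_le {C : CoarseStructure X}
    (h : C.UniformlyLocallyFinite) {T : SetRel X X} (hT : T ∈ C.controlled) :
    ∃ N : ℕ, ∀ x : X, {z | (x, z) ∈ T}.encard ≤ N := by
  obtain ⟨N, hN⟩ := h _ (C.inv_mem hT)
  refine ⟨N, fun x => ?_⟩
  have : {z | (x, z) ∈ T} = relNhd T.inv {x} := by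
    ext z; simp [relNhd]
  rw [this]
  exact hN x

theorem UniformlyLocallyFinite.finite_right {C : CoarseStructure X}
    (h : C.UniformlyLocallyFinite) {T : SetRel X X} (hT : T ∈ C.controlled) (x : X) :
    {z | (x, z) ∈ T}.Finite := by
  obtain ⟨N, hN⟩ := h.encard_right_le hT
  exact Set.finite_of_encard_le_coe (hN x)

theorem UniformlyLocallyFinite.finite_relNhd {C : CoarseStructure X}
    (h : C.UniformlyLocallyFinite) {T : SetRel X X} (hT : T ∈ C.controlled) {Y : Set X}
    (hY : Y.Finite) : (relNhd T Y).Finite := by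
  have : relNhd T Y = ⋃ y ∈ Y, relNhd T {y} := by
    ext z; simp [relNhd]
  rw [this]
  refine hY.biUnion fun y _ => ?_
  obtain ⟨N, hN⟩ := h _ hT
  exact Set.finite_of_encard_le_coe (hN y)

/-! ### Coarse components -/

theorem empty_mem (C : CoarseStructure X) : (∅ : Set (X × X)) ∈ C.controlled :=
  C.subset_mem C.diag_mem (Set.empty_subset _)

theorem mem_of_finite (C : CoarseStructure X) {S : Set (X × X)} (hS : S.Finite)
    (h : ∀ p ∈ S, ({p} : Set (X × X)) ∈ C.controlled) : S ∈ C.controlled := by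
  induction S, hS using Set.Finite.induction_on with
  | empty => exact C.empty_mem
  | @insert a s _ _ ih =>
    rw [Set.insert_eq]
    exact C.union_mem (h a (Set.mem_insert _ _)) (ih fun p hp => h p (Set.mem_insert_of_mem _ hp))

/-- Two points are in the same coarse component if the pair they form is controlled. -/
def componentSetoid (C : CoarseStructure X) : Setoid X where
  r x y := ({(x, y)} : Set (X × X)) ∈ C.controlled
  iseqv :=
    { refl := fun x => C.subset_mem C.diag_mem (by rintro _ rfl; rfl)
      symm := fun {x y} h => C.subset_mem (C.inv_mem h) (by rintro _ rfl; rfl)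
      trans := fun {x y z} h h' => C.subset_mem (C.comp_mem h h') (by
        rintro _ rfl; exact ⟨y, rfl, rfl⟩) }

/-- A point of the coarse component of `x` that depends on this component only. -/
noncomputable def componentPoint (C : CoarseStructure X) (x : X) : X :=
  (Quotient.mk C.componentSetoid x).out

theorem componentPoint_mem (C : CoarseStructure X) (x : X) :
    ({(x, C.componentPoint x)} : Set (X × X)) ∈ C.controlled :=
  C.componentSetoid.symm (Quotient.mk_out (s := C.componentSetoid) x)

theorem componentPoint_eq {C : CoarseStructure X} {T : SetRel X X} (hT : T ∈ C.controlled)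
    {x y : X} (h : (x, y) ∈ T) : C.componentPoint x = C.componentPoint y := by
  have : Quotient.mk C.componentSetoid x = Quotient.mk C.componentSetoid y :=
    Quotient.sound (C.subset_mem hT (Set.singleton_subset_iff.2 h))
  rw [componentPoint, this, componentPoint]

/-! ### Almost invariant probability vectors -/

/-- Probability vectors `η x`, `x ∈ S`, carried by the sets `{z | (x, z) ∈ F}`, such that `η x` and
`η y` are at `ℓ¹`-distance at most `ε` for all `(x, y) ∈ T`. -/
structure IsReiterOn (F T : SetRel X X) (S : Set X) (ε : ℝ) (η : X → X → ℝ) : Prop where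
  nonneg : ∀ x z, 0 ≤ η x z
  le_one : ∀ x z, η x z ≤ 1
  eq_zero : ∀ x z, (x, z) ∉ F → η x z = 0
  sum_eq : ∀ x ∈ S, ∀ s : Finset X, (∀ z, (x, z) ∈ F → z ∈ s) → ∑ z ∈ s, η x z = 1
  close : ∀ x ∈ S, ∀ y ∈ S, (x, y) ∈ T → ∀ s : Finset X, ∑ z ∈ s, |η x z - η y z| ≤ ε

theorem IsReiterOn.mono {F T T' : SetRel X X} {S S' : Set X} {ε ε' : ℝ} {η : X → X → ℝ}
    (h : IsReiterOn F T S ε η) (hT : T' ⊆ T) (hS : S' ⊆ S) (hε : ε ≤ ε') :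
    IsReiterOn F T' S' ε' η where
  nonneg := h.nonneg
  le_one := h.le_one
  eq_zero := h.eq_zero
  sum_eq x hx := h.sum_eq x (hS hx)
  close x hx y hy hxy s := (h.close x (hS hx) y (hS hy) (hT hxy) s).trans hε

/-- Since `ℓ¹`-distances are tested on finite sets only, each single condition involves finitely
many coordinates and is closed for pointwise convergence. -/
theorem isClosed_isReiterOn (F T : SetRel X X) (S : Set X) (ε : ℝ) :
    IsClosed {η | IsReiterOn F T S ε η} := by
  have : {η | IsReiterOn F T S ε η} =
      {η | ∀ x z, 0 ≤ η x z} ∩ ({η | ∀ x z, η x z ≤ 1} ∩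
      ({η | ∀ x z, (x, z) ∉ F → η x z = 0} ∩
      ({η | ∀ x ∈ S, ∀ s : Finset X, (∀ z, (x, z) ∈ F → z ∈ s) → ∑ z ∈ s, η x z = 1} ∩
      {η | ∀ x ∈ S, ∀ y ∈ S, (x, y) ∈ T → ∀ s : Finset X,
        ∑ z ∈ s, |η x z - η y z| ≤ ε}))) := by
    ext η
    exact ⟨fun h => ⟨h.1, h.2, h.3, h.4, h.5⟩, fun h => ⟨h.1, h.2.1, h.2.2.1, h.2.2.2.1, h.2.2.2.2⟩⟩
  rw [this]
  refine IsClosed.inter ?_ (IsClosed.inter ?_ (IsClosed.inter ?_ (IsClosed.inter ?_ ?_)))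
  all_goals
    simp only [Set.ofPred_forall]
    repeat refine isClosed_iInter fun _ => ?_
  · exact isClosed_le (by fun_prop) (by fun_prop)
  · exact isClosed_le (by fun_prop) (by fun_prop)
  · exact isClosed_eq (by fun_prop) (by fun_prop)
  · exact isClosed_eq (by fun_prop) (by fun_prop)
  · exact isClosed_le (by fun_prop) (by fun_prop)

/-- Compactness: it suffices to find the vectors over finite subsets. -/
theorem exists_isReiterOn_of_finset {F T : SetRel X X} {S : Set X} {ε : ℝ}
    (h : ∀ Z : Finset X, (Z : Set X) ⊆ S → ∃ η, IsReiterOn F T Z ε η) :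
    ∃ η, IsReiterOn F T S ε η := by
  classical
  have hcpt : IsCompact (Set.pi Set.univ fun _ : X => Set.pi Set.univ fun _ : X =>
      Set.Icc (0 : ℝ) 1) :=
    isCompact_univ_pi fun _ => isCompact_univ_pi fun _ => isCompact_Icc
  have hne := IsCompact.nonempty_iInter_of_directed_nonempty_isCompact_isClosed
    (fun Z : Finset X => {η | IsReiterOn F T (S ∩ Z) ε η})
    (by
      refine directed_of_isDirected_le fun Z Z' hZ η hη => ?_
      exact IsReiterOn.mono hη subset_rfl
        (Set.inter_subset_inter_right _ (Finset.coe_subset.2 hZ)) le_rfl)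
    (by
      intro Z
      obtain ⟨η, hη⟩ := h (Z.filter (· ∈ S)) (by intro x hx; simpa using (Finset.mem_filter.1 hx).2)
      exact ⟨η, hη.mono subset_rfl (fun x hx => by simpa using ⟨hx.2, hx.1⟩) le_rfl⟩)
    (fun Z => hcpt.of_isClosed_subset (isClosed_isReiterOn _ _ _ _)
      fun η hη x _ z _ => ⟨hη.nonneg x z, hη.le_one x z⟩)
    (fun Z => isClosed_isReiterOn _ _ _ _)
  obtain ⟨η, hη⟩ := hne
  simp only [Set.mem_iInter, Set.mem_ofPred_eq] at hη
  -- Every condition mentions at most two points of `S`, so the finite sets `∅`, `{x}` and `{x, y}`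
  -- suffice.
  refine ⟨η, (hη ∅).nonneg, (hη ∅).le_one, (hη ∅).eq_zero, fun x hx => ?_, fun x hx y hy => ?_⟩
  · exact (hη {x}).sum_eq x ⟨hx, by simp⟩
  · exact (hη {x, y}).close x ⟨hx, by simp⟩ y ⟨hy, by simp⟩

theorem IsReiterOn.sum_le_one {F T : SetRel X X} {S : Set X} {ε : ℝ} {η : X → X → ℝ}
    (h : IsReiterOn F T S ε η) (hF : ∀ x, {z | (x, z) ∈ F}.Finite) {x : X} (hx : x ∈ S)
    (s : Finset X) : ∑ z ∈ s, η x z ≤ 1 := by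
  classical
  rw [← h.sum_eq x hx (s ∪ (hF x).toFinset) fun z hz => by simp [hz]]
  exact Finset.sum_le_sum_of_subset_of_nonneg Finset.subset_union_left fun z _ _ => h.nonneg x z

theorem relNhd_iterate_mono {T : SetRel X X} (hrefl : ∀ x, (x, x) ∈ T) (B : Set X) :
    Monotone fun j => (relNhd T)^[j] B := by
  refine monotone_nat_of_le_succ fun n => ?_
  simp only [Function.iterate_succ_apply']
  exact fun x hx => ⟨x, hx, hrefl x⟩

/-- A finite set can be absorbed: vectors over the complement of a finite set extend to the whole
space at an arbitrarily small cost. -/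
theorem exists_isReiterOn_univ_of_compl {C : CoarseStructure X}
    (hfin : C.UniformlyLocallyFinite) {F T : SetRel X X} (hF : F ∈ C.controlled)
    (hT : T ∈ C.controlled) (hrefl : ∀ x, (x, x) ∈ T) (hsymm : ∀ x y, (x, y) ∈ T → (y, x) ∈ T)
    {B : Set X} (hB : B.Finite) {ε δ : ℝ} (hε : 0 ≤ ε) (hδ : 0 < δ) {η : X → X → ℝ}
    (hη : IsReiterOn F T Bᶜ ε η) :
    ∃ F' ∈ C.controlled, ∃ η', IsReiterOn F' T Set.univ (ε + δ) η' := by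
  classical
  -- The extra error below consists of at most three terms of size `1 / k`.
  obtain ⟨k, hk⟩ := exists_nat_gt (3 / δ)
  have hk0 : (0 : ℝ) < k := (by positivity : 0 < 3 / δ).trans hk
  have hkδ : 3 / (k : ℝ) ≤ δ := by
    rw [div_lt_iff₀ hδ] at hk
    rw [div_le_iff₀ hk0]; linarith
  let N : ℕ → Set X := fun j => (relNhd T)^[j] B
  have hNmono : Monotone N := relNhd_iterate_mono hrefl B
  have hNsucc : ∀ j, N (j + 1) = relNhd T (N j) := fun j => Function.iterate_succ_apply' _ _ _
  have hNfin : ∀ j, (N j).Finite := by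
    intro j
    induction j with
    | zero => exact hB
    | succ j ih => rw [hNsucc]; exact hfin.finite_relNhd hT ih
  -- `c / k` is a cutoff: it is `1` on `B`, vanishes off a finite neighbourhood of `B`, and changes
  -- by at most `1 / k` along `T`.
  let c : X → ℕ := fun x => ((Finset.range k).filter fun j => x ∈ N j).card
  have hcB : ∀ x ∈ B, c x = k := by
    intro x hx
    have : ((Finset.range k).filter fun j => x ∈ N j) = Finset.range k :=
      Finset.filter_true_of_mem fun j _ => hNmono (Nat.zero_le j) hx
    simp only [c, this, Finset.card_range]
  have hck : ∀ x, c x ≤ k := fun x =>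
    (Finset.card_filter_le _ _).trans (Finset.card_range k).le
  have hc1 : ∀ x y, (x, y) ∈ T → c x ≤ c y + 1 := by
    intro x y hxy
    have : c x ≤ (insert k ((Finset.range k).filter fun j => y ∈ N j)).card := by
      -- The shift `j ↦ j + 1` sends levels containing `x` to levels containing `y`; only the last
      -- one can leave the range, landing on `k`.
      refine Finset.card_le_card_of_injOn Nat.succ ?_ (Nat.succ_injective.injOn)
      intro j hj
      simp only [Finset.coe_filter, Finset.mem_range, Set.mem_ofPred_eq] at hj
      have hy : y ∈ N (j + 1) := by
        rw [hNsucc]; exact ⟨x, hj.2, hsymm _ _ hxy⟩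
      simp only [Finset.coe_insert, Finset.coe_filter, Finset.mem_range, Set.mem_insert_iff,
        Set.mem_ofPred_eq, Nat.succ_eq_add_one]
      rcases Nat.lt_or_ge (j + 1) k with h | h
      · exact Or.inr ⟨h, hy⟩
      · exact Or.inl (by omega)
    exact this.trans (Finset.card_insert_le _ _)
  have hcN : ∀ x, c x ≠ 0 → x ∈ N k := by
    intro x hx
    obtain ⟨j, hj⟩ := Finset.card_pos.1 (Nat.pos_of_ne_zero hx)
    simp only [Finset.mem_filter, Finset.mem_range] at hj
    exact hNmono hj.1.le hj.2
  let t : X → ℝ := fun x => c x / k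
  have ht0 : ∀ x, 0 ≤ t x := fun x => by positivity
  have ht1 : ∀ x, t x ≤ 1 := fun x =>
    div_le_one_of_le₀ (by exact_mod_cast hck x) hk0.le
  have htB : ∀ x ∈ B, t x = 1 := fun x hx => by simp only [t, hcB x hx]; exact div_self hk0.ne'
  have htT : ∀ x y, (x, y) ∈ T → t x ≤ t y + 1 / k := by
    intro x y h
    simp only [t, ← add_div]
    exact div_le_div_of_nonneg_right (by exact_mod_cast hc1 x y h) hk0.le
  -- Near `B` the mass is moved to a base point. It is chosen per component, as the space may be
  -- disconnected; `T`-related points share it, so their point masses agree.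
  let b : X → X := C.componentPoint
  let P : Set (X × X) := (fun x => (x, b x)) '' N k
  have hP : P ∈ C.controlled := by
    refine C.mem_of_finite ((hNfin k).image _) ?_
    rintro _ ⟨x, -, rfl⟩
    exact C.componentPoint_mem x
  have htP : ∀ x, t x ≠ 0 → (x, b x) ∈ P := by
    intro x hx
    refine ⟨x, hcN x fun h => hx ?_, rfl⟩
    simp [t, h]
  let e : X → X → ℝ := fun x z => if z = b x then 1 else 0
  have he0 : ∀ x z, 0 ≤ e x z := fun x z => by simp only [e]; split_ifs <;> norm_num
  have he1 : ∀ x z, e x z ≤ 1 := fun x z => by simp only [e]; split_ifs <;> norm_num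
  have hes : ∀ x (s : Finset X), ∑ z ∈ s, e x z ≤ 1 := by
    intro x s
    simp only [e, Finset.sum_ite_eq']
    split_ifs <;> norm_num
  have hFfin := fun x => hfin.finite_right hF x
  have hmass : ∀ x (s : Finset X), ∑ z ∈ s, (1 - t x) * η x z ≤ 1 - t x := by
    intro x s
    by_cases hx : x ∈ B
    · simp [htB x hx]
    · rw [← Finset.mul_sum]
      exact mul_le_of_le_one_right (sub_nonneg.2 (ht1 x)) (hη.sum_le_one hFfin hx s)
  refine ⟨(F ∪ P : Set (X × X)), C.union_mem hF hP,
    fun x z => (1 - t x) * η x z + t x * e x z, ?_, ?_, ?_, ?_, ?_⟩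
  · intro x z
    have := mul_nonneg (sub_nonneg.2 (ht1 x)) (hη.nonneg x z)
    have := mul_nonneg (ht0 x) (he0 x z)
    positivity
  · intro x z
    have := mul_le_of_le_one_right (sub_nonneg.2 (ht1 x)) (hη.le_one x z)
    have := mul_le_of_le_one_right (ht0 x) (he1 x z)
    linarith
  · intro x z hz
    have h1 : (x, z) ∉ F := fun h => hz (Or.inl h)
    have h2 : (x, z) ∉ P := fun h => hz (Or.inr h)
    rw [hη.eq_zero x z h1]
    by_cases hzb : z = b x
    · have : t x = 0 := by
        by_contra h
        exact h2 (hzb ▸ htP x h)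
      simp [this]
    · simp [e, hzb]
  · intro x _ s hs
    rw [Finset.sum_add_distrib, ← Finset.mul_sum, ← Finset.mul_sum]
    have h1 : (1 - t x) * ∑ z ∈ s, η x z = 1 - t x := by
      by_cases hx : x ∈ B
      · simp [htB x hx]
      · rw [hη.sum_eq x hx s fun z hz => hs z (Or.inl hz), mul_one]
    have h2 : t x * ∑ z ∈ s, e x z = t x := by
      by_cases hx : t x = 0
      · simp [hx]
      · have : b x ∈ s := hs _ (Or.inr (htP x hx))
        simp [e, this]
    rw [h1, h2]; ring
  · intro x _ y _ hxy s
    have hbxy : e y = e x := by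
      funext z
      simp only [e, b, componentPoint_eq hT hxy]
    have h1 := htT x y hxy
    have h2 := htT y x (hsymm _ _ hxy)
    have habs : |t x - t y| ≤ 1 / k := abs_le.2 ⟨by linarith, by linarith⟩
    have hE : ∑ z ∈ s, |t x - t y| * e x z ≤ 1 / k := by
      rw [← Finset.mul_sum]
      exact (mul_le_of_le_one_right (abs_nonneg _) (hes x s)).trans habs
    have h3k : 3 / (k : ℝ) = 1 / k + 1 / k + 1 / k := by ring
    rw [h3k] at hkδ
    have hk1 : 0 < 1 / (k : ℝ) := by positivity
    simp only [hbxy]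
    -- Nothing is known about `η` on `B`, but then both `1 - t x` and `1 - t y` are at most `1 / k`,
    -- so the `η`-parts can be bounded by their masses.
    by_cases hB' : x ∈ B ∨ y ∈ B
    · have hx1 : 1 - t x ≤ 1 / k := by
        rcases hB' with h | h
        · rw [htB x h]; linarith
        · rw [htB y h] at h2; linarith
      have hy1 : 1 - t y ≤ 1 / k := by
        rcases hB' with h | h
        · rw [htB x h] at h1; linarith
        · rw [htB y h]; linarith
      have key : ∀ z ∈ s, |(1 - t x) * η x z + t x * e x z - ((1 - t y) * η y z + t y * e x z)| ≤
          (1 - t x) * η x z + (1 - t y) * η y z + |t x - t y| * e x z := by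
        intro z _
        have p1 := mul_nonneg (sub_nonneg.2 (ht1 x)) (hη.nonneg x z)
        have p2 := mul_nonneg (sub_nonneg.2 (ht1 y)) (hη.nonneg y z)
        have : (1 - t x) * η x z + t x * e x z - ((1 - t y) * η y z + t y * e x z) =
          (1 - t x) * η x z + (-((1 - t y) * η y z)) + (t x - t y) * e x z := by ring
        rw [this]
        refine (abs_add_three _ _ _).trans ?_
        rw [abs_neg, abs_of_nonneg p1, abs_of_nonneg p2, abs_mul, abs_of_nonneg (he0 x z)]
      refine (Finset.sum_le_sum key).trans ?_
      rw [Finset.sum_add_distrib, Finset.sum_add_distrib]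
      have := hmass x s
      have := hmass y s
      linarith
    · obtain ⟨hxB, hyB⟩ := not_or.1 hB'
      have key : ∀ z ∈ s, |(1 - t x) * η x z + t x * e x z - ((1 - t y) * η y z + t y * e x z)| ≤
          (1 - t x) * |η x z - η y z| + |t x - t y| * η y z + |t x - t y| * e x z := by
        intro z _
        have : (1 - t x) * η x z + t x * e x z - ((1 - t y) * η y z + t y * e x z) =
          (1 - t x) * (η x z - η y z) + (-((t x - t y) * η y z)) + (t x - t y) * e x z := by ring
        rw [this]
        refine (abs_add_three _ _ _).trans ?_
        rw [abs_neg, abs_mul, abs_mul, abs_mul, abs_of_nonneg (he0 x z),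
          abs_of_nonneg (hη.nonneg y z), abs_of_nonneg (sub_nonneg.2 (ht1 x))]
      refine (Finset.sum_le_sum key).trans ?_
      rw [Finset.sum_add_distrib, Finset.sum_add_distrib, ← Finset.mul_sum, ← Finset.mul_sum]
      have q1 : (1 - t x) * ∑ z ∈ s, |η x z - η y z| ≤ ε :=
        (mul_le_of_le_one_left (Finset.sum_nonneg fun _ _ => abs_nonneg _)
          (by linarith [ht0 x])).trans (hη.close x hxB y hyB hxy s)
      have q2 : |t x - t y| * ∑ z ∈ s, η y z ≤ 1 / k :=
        (mul_le_of_le_one_right (abs_nonneg _) (hη.sum_le_one hFfin hyB s)).trans habs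
      linarith

/-! ### From probability vectors to property A -/

theorem ncard_between (s : Finset X) (f g : X → ℕ) :
    {p : X × ℕ | p.1 ∈ s ∧ f p.1 ≤ p.2 ∧ p.2 < g p.1}.ncard = ∑ z ∈ s, (g z - f z) := by
  classical
  have : {p : X × ℕ | p.1 ∈ s ∧ f p.1 ≤ p.2 ∧ p.2 < g p.1} =
      (((s.sigma fun z => Finset.Ico (f z) (g z)).map
        (Equiv.sigmaEquivProd X ℕ).toEmbedding : Finset (X × ℕ)) : Set (X × ℕ)) := by
    ext ⟨z, n⟩
    simp
  rw [this, Set.ncard_coe_finset, Finset.card_map, Finset.card_sigma]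
  simp

theorem finite_between (s : Finset X) (f g : X → ℕ) :
    {p : X × ℕ | p.1 ∈ s ∧ f p.1 ≤ p.2 ∧ p.2 < g p.1}.Finite := by
  refine ((s.finite_toSet.prod (Finset.range (s.sup g)).finite_toSet)).subset ?_
  rintro ⟨z, n⟩ ⟨h1, -, h3⟩
  exact ⟨h1, by simpa using lt_of_lt_of_le h3 (Finset.le_sup h1)⟩

/-- Property A follows from its formulation with probability vectors. -/
theorem propertyA_of_isReiterOn {C : CoarseStructure X} (hfin : C.UniformlyLocallyFinite)
    (h : ∀ ε : ℝ, 0 < ε → ∀ T ∈ C.controlled, ∃ F ∈ C.controlled, ∃ η,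
      IsReiterOn F T Set.univ ε η) : C.PropertyA := by
  classical
  intro ε hε T hT
  -- The bound `1 / 2` keeps the intersection above `K / 2 - 4 * N`; the bound `ε / 8` keeps the
  -- main part `2 * K * ε'` of the symmetric difference below `K * ε / 4`.
  set ε' : ℝ := min (1 / 2) (ε / 8) with hε'
  have hε'0 : 0 < ε' := by positivity
  have hε'1 : ε' ≤ 1 / 2 := min_le_left _ _
  have hε'2 : ε' ≤ ε / 8 := min_le_right _ _
  obtain ⟨F, hF, η, hη⟩ := h ε' hε'0 T hT
  obtain ⟨N, hN⟩ := hfin.encard_right_le hF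
  have hFfin := fun x => hfin.finite_right hF x
  -- `K` is so large that the remaining gap `K * ε / 4` exceeds all rounding errors: at most `2 * N`
  -- columns are involved, and the added points `(x, 1)` and `(y, 1)` cost `2`.
  obtain ⟨K, hK⟩ := exists_nat_gt ((4 * N + 2 + 4 * N * ε) / (ε / 4))
  rw [div_lt_iff₀ (by positivity)] at hK
  let a : X → X → ℕ := fun x z => ⌊K * η x z⌋₊
  have ha0 : ∀ x z, (x, z) ∉ F → a x z = 0 := fun x z hz => by simp [a, hη.eq_zero x z hz]
  have hale : ∀ x z, (a x z : ℝ) ≤ K * η x z := fun x z =>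
    Nat.floor_le (mul_nonneg (Nat.cast_nonneg _) (hη.nonneg x z))
  have halt : ∀ x z, (K * η x z : ℝ) - 1 ≤ a x z := fun x z => (Nat.sub_one_lt_floor _).le
  let Bx : X → Set (X × ℕ) := fun x => {p | p.2 < a x p.1}
  have hBx : ∀ x (s : Finset X), (∀ z, (x, z) ∈ F → z ∈ s) →
      Bx x = {p : X × ℕ | p.1 ∈ s ∧ 0 ≤ p.2 ∧ p.2 < a x p.1} := by
    intro x s hs
    ext ⟨z, n⟩
    simp only [Bx, Set.mem_ofPred_eq, Nat.zero_le, true_and]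
    refine ⟨fun h => ⟨hs z ?_, h⟩, fun h => h.2⟩
    by_contra hz
    rw [ha0 x z hz] at h
    exact Nat.not_lt_zero _ h
  have hBfin : ∀ x, (Bx x).Finite := by
    intro x
    rw [hBx x (hFfin x).toFinset (by simp)]
    exact finite_between _ (fun _ => 0) _
  let A : Set ((X × X) × ℕ) := {q | q.2 < a q.1.1 q.1.2 ∨ (q.1.1 = q.1.2 ∧ q.2 = 1)}
  have hslice : ∀ x, slice A x = insert (x, 1) (Bx x) := by
    intro x
    ext ⟨z, n⟩
    simp only [slice, A, Bx, Set.mem_ofPred_eq, Set.mem_insert_iff, Prod.mk.injEq]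
    constructor
    · rintro (h | ⟨rfl, rfl⟩)
      · exact Or.inr h
      · exact Or.inl ⟨rfl, rfl⟩
    · rintro (⟨rfl, rfl⟩ | h)
      · exact Or.inr ⟨rfl, rfl⟩
      · exact Or.inl h
  refine ⟨(F ∪ SetRel.id : Set (X × X)), C.union_mem hF C.diag_mem, A, ?_, ?_, ?_, ?_⟩
  · rintro ⟨⟨x, z⟩, n⟩ (h | ⟨h, -⟩)
    · refine ⟨Or.inl ?_, trivial⟩
      by_contra hz
      simp only [ha0 x z hz] at h
      exact Nat.not_lt_zero _ h
    · exact ⟨Or.inr h, trivial⟩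
  · intro x
    rw [hslice]
    exact (hBfin x).insert _
  · intro x
    exact Or.inr ⟨rfl, rfl⟩
  · intro x y hxy
    set s : Finset X := (hFfin x).toFinset ∪ (hFfin y).toFinset with hs
    have hsx : ∀ z, (x, z) ∈ F → z ∈ s := fun z hz => by simp [hs, hz]
    have hsy : ∀ z, (y, z) ∈ F → z ∈ s := fun z hz => by simp [hs, hz]
    have hcard : (s.card : ℝ) ≤ 2 * N := by
      have hc : ∀ x, (hFfin x).toFinset.card ≤ N := by
        intro x
        have := hN x
        rw [(hFfin x).encard_eq_coe_toFinset_card] at this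
        exact_mod_cast this
      have := (Finset.card_union_le (hFfin x).toFinset (hFfin y).toFinset).trans
        (add_le_add (hc x) (hc y))
      rw [two_mul]
      exact_mod_cast this
    have hclose := hη.close x trivial y trivial hxy s
    have hBcard : (K : ℝ) - 2 * N ≤ (Bx x).ncard := by
      rw [hBx x s hsx, ncard_between s (fun _ => 0)]
      push_cast [Nat.sub_zero]
      calc (K : ℝ) - 2 * N ≤ ∑ z ∈ s, (K * η x z - 1) := by
            rw [Finset.sum_sub_distrib, ← Finset.mul_sum, hη.sum_eq x trivial s hsx]
            simp only [Finset.sum_const, nsmul_eq_mul, mul_one]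
            linarith
        _ ≤ _ := Finset.sum_le_sum fun z _ => halt x z
    have hdiff : ∀ u v, (∀ z, (u, z) ∈ F → z ∈ s) →
        (∑ z ∈ s, |η u z - η v z| ≤ ε') → ((Bx u \ Bx v).ncard : ℝ) ≤ K * ε' + 2 * N := by
      intro u v hu hclose
      have : Bx u \ Bx v = {p : X × ℕ | p.1 ∈ s ∧ a v p.1 ≤ p.2 ∧ p.2 < a u p.1} := by
        rw [hBx u s hu]
        ext ⟨z, n⟩
        simp only [Bx, Set.mem_sdiff, Set.mem_ofPred_eq, not_lt]
        exact ⟨fun h => ⟨h.1.1, h.2, h.1.2.2⟩, fun h => ⟨⟨h.1, Nat.zero_le _, h.2.2⟩, h.2.1⟩⟩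
      rw [this, ncard_between]
      push_cast
      calc (∑ z ∈ s, ((a u z - a v z : ℕ) : ℝ)) ≤ ∑ z ∈ s, (K * |η u z - η v z| + 1) := by
            refine Finset.sum_le_sum fun z _ => ?_
            rcases le_total (a u z) (a v z) with h | h
            · rw [Nat.sub_eq_zero_of_le h]
              simp only [Nat.cast_zero]
              positivity
            · rw [Nat.cast_sub h]
              have h1 := hale u z
              have h2 := halt v z
              have h3 := mul_le_mul_of_nonneg_left (le_abs_self (η u z - η v z))
                (Nat.cast_nonneg (α := ℝ) K)
              linarith
        _ ≤ _ := by
            rw [Finset.sum_add_distrib, ← Finset.mul_sum]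
            simp only [Finset.sum_const, nsmul_eq_mul, mul_one]
            have := mul_le_mul_of_nonneg_left hclose (Nat.cast_nonneg (α := ℝ) K)
            linarith
    have d1 := hdiff x y hsx hclose
    have d2 := hdiff y x hsy (by simpa only [abs_sub_comm] using hclose)
    have hsd : ((slice A x ∆ slice A y).ncard : ℝ) ≤ 2 * (K * ε') + 4 * N + 2 := by
      have hsub : slice A x ∆ slice A y ⊆
          insert (x, 1) (insert (y, 1) ((Bx x \ Bx y) ∪ (Bx y \ Bx x))) := by
        rw [hslice, hslice]
        rintro p (⟨h1 | h1, h2⟩ | ⟨h1 | h1, h2⟩)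
        · exact Or.inl h1
        · exact Or.inr (Or.inr (Or.inl ⟨h1, fun h => h2 (Or.inr h)⟩))
        · exact Or.inr (Or.inl h1)
        · exact Or.inr (Or.inr (Or.inr ⟨h1, fun h => h2 (Or.inr h)⟩))
      have hfin' : (insert (x, 1) (insert (y, 1) ((Bx x \ Bx y) ∪ (Bx y \ Bx x)))).Finite :=
        ((((hBfin x).sdiff).union ((hBfin y).sdiff)).insert _).insert _
      have e1 := Set.ncard_le_ncard hsub hfin'
      have e2 := Set.ncard_insert_le (x, 1) (insert (y, 1) ((Bx x \ Bx y) ∪ (Bx y \ Bx x)))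
      have e3 := Set.ncard_insert_le (y, 1) ((Bx x \ Bx y) ∪ (Bx y \ Bx x))
      have e4 := Set.ncard_union_le (Bx x \ Bx y) (Bx y \ Bx x)
      have e5 : (slice A x ∆ slice A y).ncard ≤ (Bx x \ Bx y).ncard + (Bx y \ Bx x).ncard + 2 := by
        omega
      have e6 : ((slice A x ∆ slice A y).ncard : ℝ) ≤
        (Bx x \ Bx y).ncard + (Bx y \ Bx x).ncard + 2 := by exact_mod_cast e5
      linarith
    have hint : (K : ℝ) - 4 * N - K * ε' ≤ (slice A x ∩ slice A y).ncard := by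
      have e1 := Set.ncard_inter_add_ncard_sdiff_eq_ncard (Bx x) (Bx y) (hBfin x)
      have e2 : (Bx x ∩ Bx y).ncard ≤ (slice A x ∩ slice A y).ncard := by
        refine Set.ncard_le_ncard ?_ ?_
        · rw [hslice, hslice]
          exact Set.inter_subset_inter (Set.subset_insert _ _) (Set.subset_insert _ _)
        · rw [hslice]
          exact ((hBfin x).insert _).inter_of_left _
      have e1' : ((Bx x ∩ Bx y).ncard : ℝ) + (Bx x \ Bx y).ncard = (Bx x).ncard := by
        exact_mod_cast e1
      have e2' : ((Bx x ∩ Bx y).ncard : ℝ) ≤ (slice A x ∩ slice A y).ncard := by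
        exact_mod_cast e2
      linarith
    have hK0 : (0 : ℝ) ≤ K := Nat.cast_nonneg K
    have m1 := mul_le_mul_of_nonneg_left hε'1 hK0
    have m2 := mul_le_mul_of_nonneg_left hε'2 hK0
    have m3 := mul_le_mul_of_nonneg_left hint hε.le
    have m4 := mul_le_mul_of_nonneg_left m1 hε.le
    refine hsd.trans_lt (lt_of_lt_of_le ?_ m3)
    nlinarith

/-! ### Duality on finite sets -/

/-- Gordan's alternative. -/
theorem exists_weight_or_exists_coeff {I J : Type*} [Fintype I] [Fintype J] (M : I → J → ℝ) :
    (∃ w : J → ℝ, (∀ j, 0 ≤ w j) ∧ w ≠ 0 ∧ ∀ i, 0 ≤ ∑ j, w j * M i j) ∨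
      ∃ μ : I → ℝ, (∀ i, 0 ≤ μ i) ∧ ∀ j, ∑ i, μ i * M i j < 0 := by
  classical
  by_cases h : ∃ μ : I → ℝ, (∀ i, 0 ≤ μ i) ∧ ∀ j, ∑ i, μ i * M i j < 0
  · exact Or.inr h
  left
  let L : (I → ℝ) →ₗ[ℝ] (J → ℝ) :=
    { toFun := fun μ j => ∑ i, μ i * M i j
      map_add' := fun μ ν => by
        funext j; simp [add_mul, Finset.sum_add_distrib]
      map_smul' := fun r μ => by
        funext j; simp [mul_assoc, Finset.mul_sum] }
  let P : Set (I → ℝ) := {μ | ∀ i, 0 ≤ μ i}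
  have hPconv : Convex ℝ P := by
    intro μ hμ ν hν a b ha hb _ i
    exact add_nonneg (mul_nonneg ha (hμ i)) (mul_nonneg hb (hν i))
  let U : Set (J → ℝ) := {v | ∀ j, v j < 0}
  have hU : U = Set.pi Set.univ fun _ => Set.Iio (0 : ℝ) := by
    ext v; simp [U]
  have hUopen : IsOpen U := hU ▸ isOpen_set_pi Set.finite_univ fun _ _ => isOpen_Iio
  have hUconv : Convex ℝ U := hU ▸ convex_pi fun _ _ => convex_Iio _
  have hdisj : Disjoint U (L '' P) := by
    rw [Set.disjoint_left]
    rintro _ hv ⟨μ, hμ, rfl⟩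
    exact h ⟨μ, hμ, hv⟩
  -- If the cone `L '' P` misses the open negative orthant, a separating functional has the required
  -- weight as its coordinates.
  obtain ⟨f, u, hfU, hfP⟩ := geometric_hahn_banach_open hUconv hUopen (hPconv.linear_image L) hdisj
  have hu : u ≤ 0 := by
    have := hfP (L 0) ⟨0, fun _ => le_rfl, rfl⟩
    simpa using this
  have hf : ∀ v : J → ℝ, f v = ∑ j, f (Pi.single j 1) * v j := by
    intro v
    conv_lhs => rw [← Finset.univ_sum_single v]
    rw [map_sum]
    refine Finset.sum_congr rfl fun j _ => ?_
    have : (Pi.single j (v j) : J → ℝ) = v j • Pi.single j (1 : ℝ) := by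
      rw [← Pi.single_smul]; simp
    rw [this, map_smul, smul_eq_mul, mul_comm]
  have hone : f (fun _ => 1) > 0 := by
    have h1 : (fun _ => -1 : J → ℝ) ∈ U := fun _ => by norm_num
    have h2 := hfU _ h1
    have h3 : f (fun _ => -1) = - f (fun _ => 1) := by rw [← map_neg]; rfl
    linarith
  refine ⟨fun j => f (Pi.single j 1), fun j => ?_, ?_, fun i => ?_⟩
  · by_contra hneg
    push Not at hneg
    -- With this `r`, the functional takes the positive value `-f (Pi.single j 1) / 2` at a point of
    -- `U`.
    set r : ℝ := - f (Pi.single j 1) / (2 * f (fun _ => 1)) with hr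
    have hr0 : 0 < r := by
      rw [hr]; apply div_pos <;> linarith
    have hmem : (-(Pi.single j (1 : ℝ)) - r • (fun _ => 1 : J → ℝ)) ∈ U := by
      intro k
      have : (0 : ℝ) ≤ (Pi.single j (1 : ℝ) : J → ℝ) k := by
        rw [Pi.single_apply]; split_ifs <;> norm_num
      simp only [Pi.sub_apply, Pi.neg_apply, Pi.smul_apply, smul_eq_mul, mul_one]
      linarith
    have h1 := hfU _ hmem
    rw [map_sub, map_neg, map_smul, smul_eq_mul] at h1
    have h2 : r * f (fun _ => 1) = - f (Pi.single j 1) / 2 := by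
      rw [hr]; field_simp
    rw [h2] at h1
    linarith
  · intro h0
    have := hf (fun _ => 1)
    simp only [mul_one] at this
    rw [this] at hone
    have h1 : ∀ j, f (Pi.single j 1) = 0 := fun j => congrFun h0 j
    simp [h1] at hone
  · by_contra hneg
    push Not at hneg
    have hval : f (L (Pi.single i 1)) = ∑ j, f (Pi.single j 1) * M i j := by
      rw [hf]
      refine Finset.sum_congr rfl fun j _ => ?_
      congr 1
      change ∑ i', (Pi.single i 1 : I → ℝ) i' * M i' j = M i j
      simp [Pi.single_apply]
    rw [← hval] at hneg
    set v := f (L (Pi.single i 1)) with hv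
    -- The cone is scaled so that `f` takes the value `u - 1`, below its lower bound `u`.
    have h1 := hfP (L (((u - 1) / v) • Pi.single i 1)) ⟨_, fun k => by
      have : (0 : ℝ) ≤ (Pi.single i (1 : ℝ) : I → ℝ) k := by
        rw [Pi.single_apply]; split_ifs <;> norm_num
      have h2 : 0 ≤ (u - 1) / v := div_nonneg_of_nonpos (by linarith) hneg.le
      exact mul_nonneg h2 this, rfl⟩
    rw [map_smul, map_smul, smul_eq_mul, ← hv, div_mul_cancel₀ _ hneg.ne] at h1
    linarith

/-- Writing `|t| = 2 * max t 0 - t`, the linear part cancels because both vectors have total mass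
one. As `f` has the larger total, the positive part of the difference is at most `max (f i - g i) 0
/ ∑ f`. -/
theorem sum_abs_div_sum_sub_le {I : Type*} [Fintype I] {f g : I → ℝ} {c : ℝ}
    (hg : ∀ i, 0 ≤ g i) (hc : 0 ≤ c) (hgpos : 0 < ∑ i, g i) (hle : ∑ i, g i ≤ ∑ i, f i)
    (h : ∑ i, max (f i - g i) 0 ≤ c * ∑ i, g i) :
    ∑ i, |f i / (∑ i, f i) - g i / (∑ i, g i)| ≤ 2 * c := by
  set a := ∑ i, f i with ha
  set b := ∑ i, g i with hb
  have ha0 : 0 < a := hgpos.trans_le hle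
  have h1 : ∀ i ∈ Finset.univ, |f i / a - g i / b| ≤
      2 * (max (f i - g i) 0 / a) - (f i / a - g i / b) := by
    intro i _
    have h2 : g i / a ≤ g i / b := div_le_div_of_nonneg_left (hg i) hgpos hle
    have h3 : (f i - g i) / a ≤ max (f i - g i) 0 / a :=
      div_le_div_of_nonneg_right (le_max_left _ _) ha0.le
    have h4 : 0 ≤ max (f i - g i) 0 / a := div_nonneg (le_max_right _ _) ha0.le
    rw [sub_div] at h3
    exact abs_le.2 ⟨by linarith, by linarith⟩
  refine (Finset.sum_le_sum h1).trans ?_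
  rw [Finset.sum_sub_distrib, Finset.sum_sub_distrib, ← Finset.mul_sum, ← Finset.sum_div,
    ← Finset.sum_div, ← Finset.sum_div, ← ha, ← hb, div_self ha0.ne', div_self hgpos.ne']
  have h5 : (∑ i, max (f i - g i) 0) / a ≤ c := by
    rw [div_le_iff₀ ha0]
    exact h.trans (mul_le_mul_of_nonneg_left hle hc)
  linarith

open Classical in
/-- Probability vectors indexed by a finite type are pushed forward to `X`. -/
theorem exists_isReiterOn_of_fintype {I : Type*} [Fintype I] {F T : SetRel X X} {Z : Set X}
    {ε : ℝ} {q : X → I → ℝ} (p : I → X) (hq0 : ∀ x ∈ Z, ∀ i, 0 ≤ q x i)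
    (hq1 : ∀ x ∈ Z, ∑ i, q x i = 1) (hp : ∀ x ∈ Z, ∀ i, q x i ≠ 0 → (x, p i) ∈ F)
    (hclose : ∀ x ∈ Z, ∀ y ∈ Z, (x, y) ∈ T → ∑ i, |q x i - q y i| ≤ ε) :
    ∃ η, IsReiterOn F T Z ε η := by
  let η : X → X → ℝ := fun x z => if x ∈ Z then ∑ i, if p i = z then q x i else 0 else 0
  have hη : ∀ x ∈ Z, ∀ z, η x z = ∑ i, if p i = z then q x i else 0 := fun x hx z => if_pos hx
  have hη' : ∀ x ∉ Z, ∀ z, η x z = 0 := fun x hx z => if_neg hx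
  refine ⟨η, fun x z => ?_, fun x z => ?_, fun x z hz => ?_, fun x hx s hs => ?_,
    fun x hx y hy hxy s => ?_⟩
  · by_cases hx : x ∈ Z
    · rw [hη x hx]
      refine Finset.sum_nonneg fun i _ => ?_
      split_ifs
      exacts [hq0 x hx i, le_rfl]
    · rw [hη' x hx]
  · by_cases hx : x ∈ Z
    · rw [hη x hx, ← hq1 x hx]
      refine Finset.sum_le_sum fun i _ => ?_
      split_ifs
      exacts [le_rfl, hq0 x hx i]
    · rw [hη' x hx]
      exact zero_le_one
  · by_cases hx : x ∈ Z
    · rw [hη x hx]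
      refine Finset.sum_eq_zero fun i _ => ?_
      split_ifs with h
      · by_contra hne
        exact hz (h ▸ hp x hx i hne)
      · rfl
    · exact hη' x hx z
  · simp only [hη x hx]
    rw [Finset.sum_comm, ← hq1 x hx]
    refine Finset.sum_congr rfl fun i _ => ?_
    rw [Finset.sum_ite_eq]
    split_ifs with h
    · rfl
    · by_contra hne
      exact h (hs _ (hp x hx i (Ne.symm hne)))
  · simp only [hη x hx, hη y hy]
    refine le_trans ?_ (hclose x hx y hy hxy)
    calc ∑ z ∈ s, |(∑ i, if p i = z then q x i else 0) - ∑ i, if p i = z then q y i else 0|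
        ≤ ∑ z ∈ s, ∑ i, if p i = z then |q x i - q y i| else 0 := by
          refine Finset.sum_le_sum fun z _ => ?_
          rw [← Finset.sum_sub_distrib]
          refine (Finset.abs_sum_le_sum_abs _ _).trans (Finset.sum_le_sum fun i _ => ?_)
          split_ifs <;> simp
      _ = ∑ i, if p i ∈ s then |q x i - q y i| else 0 := by
          rw [Finset.sum_comm]
          exact Finset.sum_congr rfl fun i _ => Finset.sum_ite_eq _ _ _
      _ ≤ _ := by
          refine Finset.sum_le_sum fun i _ => ?_
          split_ifs
          exacts [le_rfl, abs_nonneg _]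

open Classical in
/-- On a finite set, either there are almost invariant probability vectors or there is a weight
for which bounded sets expand. -/
theorem exists_weight_or_exists_isReiterOn (F : SetRel X X) {T : SetRel X X}
    (hrefl : ∀ x, (x, x) ∈ T) (hsymm : ∀ x y, (x, y) ∈ T → (y, x) ∈ T) (Z : Finset X)
    {c : ℝ} (hc : 0 < c) :
    (∃ w : X → ℝ, (∀ x, 0 ≤ w x) ∧ (∃ x ∈ Z, 0 < w x) ∧
      ∀ Y ⊆ Z, (∃ p, ∀ y ∈ Y, (y, p) ∈ F) →
        (1 + c) * ∑ x ∈ Y, w x ≤ ∑ x ∈ Z with ∃ y ∈ Y, (x, y) ∈ T, w x) ∨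
      ∃ η, IsReiterOn F T Z (2 * c) η := by
  let I := {Y // Y ∈ Z.powerset.filter fun Y => ∃ p, ∀ y ∈ Y, (y, p) ∈ F}
  let _ : Fintype I := Finset.Subtype.fintype _
  let M : I → Z → ℝ := fun i j =>
    (if ∃ y ∈ i.1, ((j : X), y) ∈ T then 1 else 0) - (1 + c) * (if (j : X) ∈ i.1 then 1 else 0)
  rcases exists_weight_or_exists_coeff M with ⟨w, hw0, hwne, hw⟩ | ⟨μ, hμ0, hμ⟩
  · left
    refine ⟨fun x => if h : x ∈ Z then w ⟨x, h⟩ else 0, fun x => ?_, ?_, fun Y hYZ hY => ?_⟩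
    · dsimp only
      split_ifs with h
      · exact hw0 _
      · exact le_rfl
    · obtain ⟨j, hj⟩ := Function.ne_iff.1 hwne
      refine ⟨j, j.2, ?_⟩
      simp only [j.2, dif_pos]
      exact lt_of_le_of_ne (hw0 j) (Ne.symm hj)
    · set W : X → ℝ := fun x => if h : x ∈ Z then w ⟨x, h⟩ else 0 with hW
      have h1 := hw ⟨Y, by simp [hYZ, hY]⟩
      have h2 : ∑ j : Z, w j * M ⟨Y, by simp [hYZ, hY]⟩ j =
          ∑ x ∈ Z, W x * ((if ∃ y ∈ Y, (x, y) ∈ T then 1 else 0) -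
            (1 + c) * (if x ∈ Y then 1 else 0)) := by
        rw [← Finset.sum_coe_sort Z]
        refine Finset.sum_congr rfl fun j _ => ?_
        simp [M, hW]
      rw [h2] at h1
      simp only [mul_sub, Finset.sum_sub_distrib] at h1
      have h3 : ∑ x ∈ Z, W x * (if ∃ y ∈ Y, (x, y) ∈ T then 1 else 0) =
          ∑ x ∈ Z with ∃ y ∈ Y, (x, y) ∈ T, W x := by
        rw [Finset.sum_filter]
        exact Finset.sum_congr rfl fun x _ => by split_ifs <;> simp
      have h4 : ∑ x ∈ Z, W x * ((1 + c) * (if x ∈ Y then 1 else 0)) =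
          (1 + c) * ∑ x ∈ Y, W x := by
        rw [Finset.mul_sum, ← Finset.inter_eq_right.2 hYZ, ← Finset.sum_ite_mem]
        refine Finset.sum_congr rfl fun x hx => ?_
        by_cases hxY : x ∈ Y
        · simp [hxY, hx, mul_comm]
        · simp [hxY]
      rw [h3, h4] at h1
      linarith
  · right
    -- Each bounded set sends its coefficient to a single centre, `F`-related to all its points.
    have hp : ∀ i : I, ∃ p, ∀ y ∈ i.1, (y, p) ∈ F := fun i => (Finset.mem_filter.1 i.2).2
    choose p hp using hp
    let ξ : X → I → ℝ := fun x i => if x ∈ i.1 then μ i else 0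
    let N : X → ℝ := fun x => ∑ i, ξ x i
    have hξ0 : ∀ x i, 0 ≤ ξ x i := fun x i => by
      simp only [ξ]; split_ifs
      · exact hμ0 i
      · exact le_rfl
    have hexp : ∀ x ∈ Z, ∑ i : I, (if ∃ y ∈ i.1, (x, y) ∈ T then μ i else 0) < (1 + c) * N x := by
      intro x hx
      have h1 := hμ ⟨x, hx⟩
      simp only [M, mul_sub, Finset.sum_sub_distrib, mul_ite, mul_one, mul_zero] at h1
      have h2 : (1 + c) * N x = ∑ i : I, if x ∈ i.1 then μ i * (1 + c) else 0 := by
        simp only [N, ξ, Finset.mul_sum]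
        exact Finset.sum_congr rfl fun i _ => by split_ifs <;> ring
      rw [h2]
      linarith
    have hNpos : ∀ x ∈ Z, 0 < N x := by
      intro x hx
      have h1 : 0 ≤ ∑ i : I, (if ∃ y ∈ i.1, (x, y) ∈ T then μ i else 0) :=
        Finset.sum_nonneg fun i _ => by
          split_ifs
          · exact hμ0 i
          · exact le_rfl
      exact pos_of_mul_pos_right (h1.trans_lt (hexp x hx)) (by linarith)
    -- For `T`-related `x` and `y`, a set containing either one has `y` in its `T`-neighbourhood, so
    -- `∑ max (ξ x i) (ξ y i)` is controlled by `hexp` at `y`.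
    have hbdry : ∀ x y, (x, y) ∈ T → y ∈ Z → ∑ i, max (ξ x i - ξ y i) 0 ≤ c * N y := by
      intro x y hxy hy
      have h1 : ∑ i : I, (max (ξ x i - ξ y i) 0 + ξ y i) ≤
          ∑ i : I, (if ∃ u ∈ i.1, (y, u) ∈ T then μ i else 0) := by
        refine Finset.sum_le_sum fun i _ => ?_
        have hi := hμ0 i
        rw [max_add, sub_add_cancel, zero_add, max_le_iff]
        constructor
        · by_cases hxi : x ∈ i.1
          · rw [if_pos ⟨x, hxi, hsymm _ _ hxy⟩]
            exact (if_pos hxi).le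
          · simp only [ξ, if_neg hxi]
            split_ifs
            exacts [hi, le_rfl]
        · by_cases hyi : y ∈ i.1
          · rw [if_pos ⟨y, hyi, hrefl y⟩]
            exact (if_pos hyi).le
          · simp only [ξ, if_neg hyi]
            split_ifs
            exacts [hi, le_rfl]
      rw [Finset.sum_add_distrib] at h1
      have h2 := hexp y hy
      have h3 : ∑ i, ξ y i = N y := rfl
      rw [h3] at h1
      linarith
    refine exists_isReiterOn_of_fintype (q := fun x i => ξ x i / N x) p
      (fun x hx i => div_nonneg (hξ0 x i) (hNpos x hx).le)
      (fun x hx => by rw [← Finset.sum_div]; exact div_self (hNpos x hx).ne')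
      (fun x _ i hi => hp i x ?_) fun x hx y hy hxy => ?_
    · by_contra hxi
      exact hi (by simp [ξ, hxi])
    · rcases le_total (N y) (N x) with h | h
      · exact sum_abs_div_sum_sub_le (hξ0 y) hc.le (hNpos y hy) h (hbdry x y hxy hy)
      · refine (Finset.sum_congr rfl fun i _ => abs_sub_comm _ _).trans_le ?_
        exact sum_abs_div_sum_sub_le (hξ0 x) hc.le (hNpos x hx) h (hbdry y x (hsymm _ _ hxy) hx)

/-! ### Expanding weights far out -/

open Classical in
/-- Without property A there are expanding weights on finite sets away from any given finite set. -/
theorem exists_weight_of_not_propertyA {C : CoarseStructure X} (hfin : C.UniformlyLocallyFinite)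
    (hA : ¬ C.PropertyA) :
    ∃ T ∈ C.controlled, ∃ c : ℝ, 0 < c ∧ ∀ F ∈ C.controlled, ∀ B : Finset X,
      ∃ Z : Finset X, Disjoint Z B ∧ Z.Nonempty ∧ ∃ w : X → ℝ, (∀ x ∈ Z, 0 < w x) ∧
        ∀ Y ⊆ Z, (∃ p, ∀ y ∈ Y, (y, p) ∈ F) →
          (1 + c) * ∑ x ∈ Y, w x ≤ ∑ x ∈ Z with ∃ y ∈ Y, (x, y) ∈ T, w x := by
  have h := mt (propertyA_of_isReiterOn hfin) hA
  push Not at h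
  obtain ⟨ε, hε, T₀, hT₀, h⟩ := h
  set T : SetRel X X := ((T₀ ∪ T₀.inv) ∪ SetRel.id : Set (X × X)) with hTdef
  have hT : T ∈ C.controlled := C.union_mem (C.union_mem hT₀ (C.inv_mem hT₀)) C.diag_mem
  have hrefl : ∀ x, (x, x) ∈ T := fun x => Or.inr rfl
  have hsymm : ∀ x y, (x, y) ∈ T → (y, x) ∈ T := by
    rintro x y ((h | h) | h)
    · exact Or.inl (Or.inr h)
    · exact Or.inl (Or.inl h)
    · exact Or.inr (Eq.symm h)
  -- Duality gives error `2 * (ε / 4)`, and absorbing `B` costs another `ε / 2`.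
  refine ⟨T, hT, ε / 4, by positivity, fun F hF B => ?_⟩
  have hZ : ∃ Z : Finset X, (Z : Set X) ⊆ (B : Set X)ᶜ ∧
      ∀ η, ¬ IsReiterOn F T Z (2 * (ε / 4)) η := by
    by_contra hcon
    push Not at hcon
    obtain ⟨η, hη⟩ := exists_isReiterOn_of_finset hcon
    obtain ⟨F', hF', η', hη'⟩ := exists_isReiterOn_univ_of_compl hfin hF hT hrefl hsymm
      B.finite_toSet (by positivity) (half_pos hε) hη
    exact h F' hF' η' (hη'.mono (fun p hp => Or.inl (Or.inl hp)) subset_rfl (by linarith))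
  obtain ⟨Z, hZB, hZ⟩ := hZ
  rcases exists_weight_or_exists_isReiterOn F hrefl hsymm Z (c := ε / 4) (by positivity) with
    ⟨w, hw0, ⟨x₀, hx₀, hwx₀⟩, hw⟩ | ⟨η, hη⟩
  swap
  · exact absurd hη (hZ η)
  -- Discarding points of weight zero changes neither side of the inequality and makes the support
  -- full.
  refine ⟨Z.filter fun x => 0 < w x, ?_, ⟨x₀, by simp [hx₀, hwx₀]⟩, w,
    fun x hx => (Finset.mem_filter.1 hx).2,
    fun Y hY hYF => ?_⟩
  · rw [Finset.disjoint_left]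
    exact fun x hx hxB => hZB (Finset.mem_filter.1 hx).1 hxB
  · refine (hw Y (hY.trans (Finset.filter_subset _ _)) hYF).trans (le_of_eq ?_)
    rw [Finset.filter_filter]
    refine (Finset.sum_subset (fun x hx => ?_) fun x hx hx' => ?_).symm
    · simp only [Finset.mem_filter] at hx ⊢
      exact ⟨hx.1, hx.2.2⟩
    · simp only [Finset.mem_filter, not_and] at hx hx'
      by_contra hne
      exact hx' hx.1 (lt_of_le_of_ne (hw0 x) (Ne.symm hne)) hx.2

/-! ### Atomic measures and box subspaces -/

theorem discreteMeasure_apply_finset (μ : DiscreteMeasure X) (s : Finset X) :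
    μ (s : Set X) = ∑ x ∈ s, μ {x} := by
  let _ : MeasurableSpace X := ⊤
  exact (MeasureTheory.sum_measure_singleton (μ := μ) (s := s)).symm

/-- The measure with finitely many atoms of prescribed masses. -/
noncomputable def atomicMeasure (Z : Finset X) (w : X → ℝ) : DiscreteMeasure X :=
  letI : MeasurableSpace X := ⊤
  ∑ x ∈ Z, ENNReal.ofReal (w x) • MeasureTheory.Measure.dirac x

theorem atomicMeasure_apply {Z : Finset X} {w : X → ℝ} (hw : ∀ x ∈ Z, 0 ≤ w x) (s : Set X)
    [DecidablePred (· ∈ s)] :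
    atomicMeasure Z w s = ENNReal.ofReal (∑ x ∈ Z with x ∈ s, w x) := by
  let _ : MeasurableSpace X := ⊤
  have : atomicMeasure Z w s =
      ∑ x ∈ Z, ENNReal.ofReal (w x) * MeasureTheory.Measure.dirac x s := by
    simp [atomicMeasure, MeasureTheory.Measure.finsetSum_apply]
  rw [this, ENNReal.ofReal_sum_of_nonneg fun x hx => hw x (Finset.mem_filter.1 hx).1,
    Finset.sum_filter]
  refine Finset.sum_congr rfl fun x _ => ?_
  rw [MeasureTheory.Measure.dirac_apply' _ MeasurableSpace.measurableSet_top]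
  by_cases h : x ∈ s <;> simp [h]

theorem UniformlyLocallyFinite.boxSubspace {C : CoarseStructure X}
    (hfin : C.UniformlyLocallyFinite) (E : ℕ → Set X)
    (hE : Pairwise (Function.onFun Disjoint E)) : (C.boxSubspace E hE).UniformlyLocallyFinite := by
  rintro _ ⟨T, hT, rfl⟩
  obtain ⟨N, hN⟩ := hfin T hT
  refine ⟨N, fun x => le_trans ?_ (hN x)⟩
  rw [← Subtype.val_injective.encard_image]
  refine Set.encard_le_encard ?_
  rintro _ ⟨y, ⟨_, hx, h, -⟩, rfl⟩
  obtain rfl := hx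
  exact ⟨_, rfl, h⟩

theorem isBoxSpace_boxSubspace {C : CoarseStructure X}
    (hfin : C.UniformlyLocallyFinite) {E : ℕ → Set X}
    (hE : Pairwise (Function.onFun Disjoint E)) (hEfin : ∀ m, (E m).Finite)
    (hEne : ∀ m, (E m).Nonempty) :
    (C.boxSubspace E hE).IsBoxSpace fun m => Subtype.val ⁻¹' E m where
  uniformlyLocallyFinite := hfin.boxSubspace E hE
  disjoint := fun m n hmn => (hE hmn).preimage _
  iUnion_eq := by
    ext x
    simpa using Set.mem_iUnion.1 x.2
  finite m := (hEfin m).preimage Subtype.val_injective.injOn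
  nonempty m := by
    obtain ⟨x, hx⟩ := hEne m
    exact ⟨⟨x, Set.mem_iUnion.2 ⟨m, hx⟩⟩, hx⟩
  controlled_subset := by
    rintro _ ⟨T, hT, rfl⟩ p ⟨-, m, h1, h2⟩
    exact Set.mem_iUnion.2 ⟨m, h1, h2⟩

/-! ### Failure of property A yields an expander -/

theorem exists_isWeightedWeakExpander {C : CoarseStructure X} (hgen : C.CountablyGenerated)
    (hfin : C.UniformlyLocallyFinite) (hA : ¬ C.PropertyA) :
    ∃ (E : ℕ → Set X) (hE : Pairwise (Function.onFun Disjoint E)),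
      (∀ m, (E m).Finite) ∧
      ∃ w : ℕ → DiscreteMeasure (⋃ m, E m : Set X),
        (C.boxSubspace E hE).IsWeightedWeakExpander (fun m => Subtype.val ⁻¹' E m) w := by
  classical
  obtain ⟨F, hFmono, hFC, hFcof⟩ := hgen.exists_monotone_cofinal
  obtain ⟨T, hT, c, hc, h⟩ := exists_weight_of_not_propertyA hfin hA
  choose Z hZB hZne w hw0 hw using fun n => h (F n) (hFC n)
  -- `B n` collects the earlier blocks; block `n` avoids it and expands for `F n`-bounded sets.
  let B : ℕ → Finset X := fun n => Nat.rec ∅ (fun n B => B ∪ Z n B) n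
  have hBsucc : ∀ n, B (n + 1) = B n ∪ Z n (B n) := fun n => rfl
  have hBmono : Monotone B := monotone_nat_of_le_succ fun n => by
    rw [hBsucc]; exact Finset.subset_union_left
  let Zs : ℕ → Finset X := fun n => Z n (B n)
  let E : ℕ → Set X := fun n => Zs n
  have hlt : ∀ m n, m < n → Disjoint (E m) (E n) := by
    intro m n hmn
    have h1 : Zs m ⊆ B n := by
      refine Finset.Subset.trans ?_ (hBmono (Nat.succ_le_of_lt hmn))
      rw [Nat.succ_eq_add_one, hBsucc]
      exact Finset.subset_union_right
    exact (Finset.disjoint_coe.2 ((hZB n (B n)).mono_right h1)).symm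
  have hE : Pairwise (Function.onFun Disjoint E) := by
    intro m n hmn
    rcases lt_or_gt_of_ne hmn with h | h
    · exact hlt m n h
    · exact (hlt n m h).symm
  let Q : ℕ → Finset (⋃ m, E m : Set X) := fun n => (Zs n).subtype (· ∈ ⋃ m, E m)
  have hQ : ∀ n x, x ∈ Q n ↔ (x : X) ∈ Zs n := fun n x => Finset.mem_subtype
  let W : ℕ → X → ℝ := fun n => w n (B n)
  have hWpos : ∀ n, ∀ x ∈ Q n, 0 < W n x := fun n x hx => hw0 n (B n) x ((hQ n x).1 hx)
  have happ : ∀ n s [DecidablePred (· ∈ s)], atomicMeasure (Q n) (fun x => W n x) s =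
      ENNReal.ofReal (∑ x ∈ Q n with x ∈ s, W n x) :=
    fun n s _ => atomicMeasure_apply (fun x hx => (hWpos n x hx).le) s
  refine ⟨E, hE, fun m => (Zs m).finite_toSet, fun n => atomicMeasure (Q n) fun x => W n x,
    ⟨isBoxSpace_boxSubspace hfin hE (fun m => (Zs m).finite_toSet) fun m => hZne m (B m),
      fun m => ?_, fun m => ?_, fun m x hx => ?_⟩, ?_⟩
  · rw [happ]; exact ENNReal.ofReal_lt_top
  · rw [happ, Finset.filter_false_of_mem]
    · simp
    · intro x hx hx'
      exact hx' ((hQ m x).1 hx)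
  · have hx' : x ∈ Q m := (hQ m x).2 hx
    rw [happ]
    refine (ENNReal.ofReal_pos.2 ?_).ne'
    have : ({y ∈ Q m | y ∈ ({x} : Set _)}) = {x} := by
      ext y
      simp only [Set.mem_singleton_iff, Finset.mem_filter, Finset.mem_singleton]
      exact ⟨fun h => h.2, fun h => ⟨h ▸ hx', h⟩⟩
    rw [this, Finset.sum_singleton]
    exact hWpos m x hx'
  -- Halving `c` makes the inequality for the liminf strict.
  · refine ⟨_, ⟨T, hT, rfl⟩, (c / 2).toNNReal, by simpa using hc, ?_⟩
    rintro _ ⟨R, hR, rfl⟩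
    obtain ⟨n₀, hn₀⟩ := hFcof R hR
    have hlt : 1 + ((c / 2).toNNReal : ℝ≥0∞) < ENNReal.ofReal (1 + c) := by
      rw [ENNReal.ofReal_add zero_le_one hc.le, ENNReal.ofReal_one]
      refine ENNReal.add_lt_add_left ENNReal.one_ne_top ?_
      exact (ENNReal.ofReal_lt_ofReal_iff hc).2 (by linarith)
    refine hlt.trans_le (Filter.le_liminf_of_le (by isBoundedDefault) ?_)
    filter_upwards [Filter.eventually_ge_atTop n₀] with m hm
    refine le_iInf₂ fun Y hY => ?_
    obtain ⟨hYne, hYE, p, hYp⟩ := hY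
    set YB : Finset (⋃ m, E m : Set X) := {x ∈ Q m | x ∈ Y} with hYB
    have hYB' : ∀ x, x ∈ YB ↔ x ∈ Y := by
      intro x
      rw [hYB, Finset.mem_filter, and_iff_right_iff_imp]
      exact fun hx => (hQ m x).2 (hYE hx)
    have hpos : 0 < ∑ x ∈ YB, W m x := by
      obtain ⟨y, hy⟩ := hYne
      exact Finset.sum_pos (fun x hx => hWpos m x (Finset.mem_filter.1 hx).1) ⟨y, (hYB' y).2 hy⟩
    rw [happ, happ, ENNReal.le_div_iff_mul_le (Or.inl (ENNReal.ofReal_pos.2 hpos).ne')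
      (Or.inl ENNReal.ofReal_ne_top), ← ENNReal.ofReal_mul (by linarith)]
    refine ENNReal.ofReal_le_ofReal ?_
    let ι : (⋃ m, E m : Set X) ↪ X := Function.Embedding.subtype _
    have hexp := hw m (B m) (YB.map ι) ?_ ⟨p, ?_⟩
    · rw [Finset.sum_map] at hexp
      refine hexp.trans (le_of_eq ?_)
      have : (Finset.filter (fun x => x ∈ relNhd {q : (⋃ m, E m : Set X) × (⋃ m, E m : Set X) |
          ((q.1 : X), (q.2 : X)) ∈ T ∧ ∃ m, (q.1 : X) ∈ E m ∧ (q.2 : X) ∈ E m} Y) (Q m)).map ι =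
          Finset.filter (fun x => ∃ y ∈ YB.map ι, (x, y) ∈ T) (Zs m) := by
        ext x
        simp only [Finset.mem_map, Finset.mem_filter]
        constructor
        · rintro ⟨x, ⟨hx, y, hy, hxy, -⟩, rfl⟩
          exact ⟨(hQ m x).1 hx, y, ⟨y, (hYB' y).2 hy, rfl⟩, hxy⟩
        · rintro ⟨hx, _, ⟨y, hy, rfl⟩, hxy⟩
          have hxE : x ∈ ⋃ m, E m := Set.mem_iUnion.2 ⟨m, hx⟩
          exact ⟨⟨x, hxE⟩, ⟨(hQ m ⟨x, hxE⟩).2 hx, y, (hYB' y).1 hy, hxy, m, hx,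
            hYE ((hYB' y).1 hy)⟩, rfl⟩
      rw [← this, Finset.sum_map]
      rfl
    · intro x hx
      obtain ⟨y, hy, rfl⟩ := Finset.mem_map.1 hx
      exact (hQ m y).1 (Finset.mem_filter.1 hy).1
    · intro x hx
      obtain ⟨y, hy, rfl⟩ := Finset.mem_map.1 hx
      obtain ⟨_, rfl, hyp, -⟩ := hYp ((hYB' y).1 hy)
      exact hFmono hm (hn₀ hyp)

/-! ### An expander excludes property A -/

/-- Double counting in one block: summing `w (T[Y p]) ≥ (1 + c) * w (Y p)` over `p` compares `#⋃
A_y`, over the `T`-neighbours `y` of `x`, with `#A_x` on weighted average. The ratio must be at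
least `1 + c`, while property A keeps it below. -/
theorem not_propertyA_of_isWeightedWeakExpander {C : CoarseStructure X}
    (hfin : C.UniformlyLocallyFinite) {E : ℕ → Set X}
    (hE : Pairwise (Function.onFun Disjoint E)) {w : ℕ → DiscreteMeasure (⋃ m, E m : Set X)}
    (hw : (C.boxSubspace E hE).IsWeightedWeakExpander (fun m => Subtype.val ⁻¹' E m) w) :
    ¬ C.PropertyA := by
  classical
  intro hA
  obtain ⟨⟨hbox, hwfin, -, hwsupp⟩, _, ⟨T, hT, rfl⟩, c, hc, hexp⟩ := hw
  obtain ⟨N, hN⟩ := hfin.encard_right_le hT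
  have hcR : (0 : ℝ) < c := hc
  -- At most `N` neighbours each contribute a fraction `c / (N + 1)` of new elements, in total less
  -- than `c`.
  obtain ⟨F, hF, A, hAF, hAfin, hAdiag, hAT⟩ :=
    hA (c / (N + 1)) (by positivity) T hT
  -- Points whose slices share `p` are both `F`-related to `p.1`, which may lie outside the block;
  -- with `F.comp F.inv` a point of the level set serves as centre.
  have hexpF := hexp _ ⟨F.comp F.inv, C.comp_mem hF (C.inv_mem hF), rfl⟩
  obtain ⟨m, hm⟩ := (Filter.eventually_lt_of_lt_liminf hexpF).exists
  set E' : Finset (⋃ m, E m : Set X) := (hbox.finite m).toFinset with hE'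
  have hmem : ∀ x : (⋃ m, E m : Set X), x ∈ E' ↔ (x : X) ∈ E m := by
    intro x; simp [hE']
  set TB : SetRel (⋃ m, E m : Set X) (⋃ m, E m : Set X) :=
    {p | ((p.1 : X), (p.2 : X)) ∈ T ∧ ∃ m, (p.1 : X) ∈ E m ∧ (p.2 : X) ∈ E m} with hTB
  let W : (⋃ m, E m : Set X) → ℝ := fun x => (w m {x}).toReal
  have hfinm : ∀ s, w m s ≠ ∞ := fun s =>
    ((MeasureTheory.measure_mono (Set.subset_univ s)).trans_lt (hwfin m)).ne
  have hWpos : ∀ x ∈ E', 0 < W x := fun x hx =>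
    ENNReal.toReal_pos (hwsupp m x ((hmem x).1 hx)) (hfinm _)
  have hW : ∀ s : Finset (⋃ m, E m : Set X), w m s = ENNReal.ofReal (∑ x ∈ s, W x) := by
    intro s
    rw [discreteMeasure_apply_finset, ENNReal.ofReal_sum_of_nonneg fun _ _ => ENNReal.toReal_nonneg]
    exact Finset.sum_congr rfl fun x _ => (ENNReal.ofReal_toReal (hfinm _)).symm
  let a : (⋃ m, E m : Set X) → Finset (X × ℕ) := fun x => (hAfin x).toFinset
  have ha : ∀ x p, p ∈ a x ↔ ((x.1, p.1), p.2) ∈ A := fun x p => by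
    simp [a, slice]
  let P : Finset (X × ℕ) := E'.biUnion a
  let Y : X × ℕ → Finset (⋃ m, E m : Set X) := fun p => E'.filter fun x => p ∈ a x
  let TY : X × ℕ → Finset (⋃ m, E m : Set X) := fun p =>
    E'.filter fun x => ∃ y ∈ E', (x, y) ∈ TB ∧ p ∈ a y
  have hY : ∀ p ∈ P, (1 + c) * ∑ x ∈ Y p, W x ≤ ∑ x ∈ TY p, W x := by
    intro p hp
    obtain ⟨x₀, hx₀, hpx₀⟩ := Finset.mem_biUnion.1 hp
    have hx₀Y : x₀ ∈ Y p := Finset.mem_filter.2 ⟨hx₀, hpx₀⟩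
    have hYpos : 0 < ∑ x ∈ Y p, W x :=
      Finset.sum_pos (fun x hx => hWpos x (Finset.mem_filter.1 hx).1) ⟨x₀, hx₀Y⟩
    have hmY := hm.trans_le (iInf₂_le (Y p : Set (⋃ m, E m : Set X)) ⟨⟨x₀, hx₀Y⟩,
      fun x hx => (hmem x).1 (Finset.mem_filter.1 hx).1, x₀, fun x hx => by
        have hx' := Finset.mem_filter.1 hx
        refine ⟨x₀, rfl, ⟨p.1, ?_, ?_⟩, m, (hmem x).1 hx'.1, (hmem x₀).1 hx₀⟩
        · exact (hAF ((ha x p).1 hx'.2)).1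
        · exact (hAF ((ha x₀ p).1 hpx₀)).1⟩)
    have hTY : relNhd TB (Y p : Set (⋃ m, E m : Set X)) = TY p := by
      ext x
      simp only [relNhd, Y, TY, Set.mem_ofPred_eq, Finset.coe_filter]
      constructor
      · rintro ⟨y, ⟨hy, hpy⟩, hxy⟩
        refine ⟨?_, y, hy, hxy, hpy⟩
        obtain ⟨-, k, hxk, hyk⟩ := hxy
        obtain rfl : k = m := by
          by_contra hkm
          exact Set.disjoint_left.1 (hE hkm) hyk ((hmem y).1 hy)
        exact (hmem x).2 hxk
      · rintro ⟨-, y, hy, hxy, hpy⟩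
        exact ⟨y, ⟨hy, hpy⟩, hxy⟩
    rw [hTY, hW, hW] at hmY
    have h1 := ENNReal.mul_lt_of_lt_div hmY
    have h2 : (1 + (c : ℝ≥0∞)) = ENNReal.ofReal (1 + c) := by
      rw [ENNReal.ofReal_add zero_le_one hcR.le, ENNReal.ofReal_one, ENNReal.ofReal_coe_nnreal]
    rw [h2, ← ENNReal.ofReal_mul (by positivity)] at h1
    exact ((ENNReal.ofReal_lt_ofReal_iff_of_nonneg (by positivity)).1 h1).le
  have hsumY : ∑ p ∈ P, ∑ x ∈ Y p, W x = ∑ x ∈ E', W x * (a x).card := by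
    simp only [Y, Finset.sum_filter]
    rw [Finset.sum_comm]
    refine Finset.sum_congr rfl fun x hx => ?_
    rw [← Finset.sum_filter, Finset.sum_const, nsmul_eq_mul, mul_comm]
    congr 3
    ext p
    simp only [P, Finset.mem_filter, Finset.mem_biUnion, and_iff_right_iff_imp]
    exact fun h => ⟨x, hx, h⟩
  have hcount : ∀ x ∈ E',
      ((P.filter fun p => ∃ y ∈ E', (x, y) ∈ TB ∧ p ∈ a y).card : ℝ) ≤
        (1 + N * (c / (N + 1))) * (a x).card := by
    intro x hx
    set D : Finset (⋃ m, E m : Set X) := E'.filter fun y => (x, y) ∈ TB with hD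
    have hDcard : D.card ≤ N := by
      have h1 : ((D.map (Function.Embedding.subtype _) : Finset X) : Set X) ⊆
          {z | ((x : X), z) ∈ T} := by
        intro z hz
        obtain ⟨y, hy, rfl⟩ := Finset.mem_map.1 hz
        exact (Finset.mem_filter.1 hy).2.1
      have h2 := (Set.encard_le_encard h1).trans (hN x)
      rw [Set.encard_coe_eq_coe_finsetCard, Finset.card_map] at h2
      exact_mod_cast h2
    have hsub : (P.filter fun p => ∃ y ∈ E', (x, y) ∈ TB ∧ p ∈ a y) ⊆
        a x ∪ D.biUnion fun y => a y \ a x := by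
      intro p hp
      obtain ⟨-, y, hy, hxy, hpy⟩ := Finset.mem_filter.1 hp
      by_cases hpx : p ∈ a x
      · exact Finset.mem_union_left _ hpx
      · exact Finset.mem_union_right _ (Finset.mem_biUnion.2
          ⟨y, Finset.mem_filter.2 ⟨hy, hxy⟩, Finset.mem_sdiff.2 ⟨hpy, hpx⟩⟩)
    have hdiff : ∀ y ∈ D, ((a y \ a x).card : ℝ) ≤ c / (N + 1) * (a x).card := by
      intro y hy
      have h1 := hAT x y (Finset.mem_filter.1 hy).2.1
      have h2 : ((a y \ a x).card : ℝ) ≤ (slice A x ∆ slice A y).ncard := by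
        rw [← Set.ncard_coe_finset]
        refine Nat.cast_le.2 (Set.ncard_le_ncard ?_ ?_)
        · intro p hp
          simp only [a, Finset.coe_sdiff, Set.Finite.coe_toFinset] at hp
          exact Or.inr hp
        · exact ((hAfin x).sdiff).union ((hAfin y).sdiff)
      have h3 : ((slice A x ∩ slice A y).ncard : ℝ) ≤ (a x).card := by
        rw [← Set.ncard_coe_finset]
        refine Nat.cast_le.2 (Set.ncard_le_ncard ?_ (Finset.finite_toSet _))
        simp only [a, Set.Finite.coe_toFinset]
        exact Set.inter_subset_left
      exact h2.trans (h1.le.trans (mul_le_mul_of_nonneg_left h3 (by positivity)))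
    have h1 : ((P.filter fun p => ∃ y ∈ E', (x, y) ∈ TB ∧ p ∈ a y).card : ℝ) ≤
        (a x).card + ∑ y ∈ D, ((a y \ a x).card : ℝ) := by
      have := (Finset.card_le_card hsub).trans ((Finset.card_union_le _ _).trans
        (Nat.add_le_add_left Finset.card_biUnion_le _))
      exact_mod_cast this
    have h2 : ∑ y ∈ D, ((a y \ a x).card : ℝ) ≤ N * (c / (N + 1) * (a x).card) := by
      refine (Finset.sum_le_card_nsmul _ _ _ hdiff).trans ?_
      rw [nsmul_eq_mul]
      exact mul_le_mul_of_nonneg_right (by exact_mod_cast hDcard) (by positivity)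
    linarith
  have hsumTY : ∑ p ∈ P, ∑ x ∈ TY p, W x ≤
      (1 + N * (c / (N + 1))) * ∑ x ∈ E', W x * (a x).card := by
    simp only [TY, Finset.sum_filter]
    rw [Finset.sum_comm, Finset.mul_sum]
    refine Finset.sum_le_sum fun x hx => ?_
    rw [← Finset.sum_filter, Finset.sum_const, nsmul_eq_mul]
    have := mul_le_mul_of_nonneg_right (hcount x hx) (hWpos x hx).le
    linarith
  have hpos : 0 < ∑ x ∈ E', W x * (a x).card := by
    obtain ⟨x₀, hx₀⟩ := hbox.nonempty m
    refine Finset.sum_pos (fun x hx => mul_pos (hWpos x hx) ?_) ⟨x₀, (hmem x₀).2 hx₀⟩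
    -- The prescribed point `(x, 1)` keeps every slice nonempty, so the total can be cancelled.
    exact Nat.cast_pos.2 (Finset.card_pos.2 ⟨(x, 1), (ha x _).2 (hAdiag x)⟩)
  have hle := Finset.sum_le_sum hY
  rw [← Finset.mul_sum, hsumY] at hle
  have hfinal := le_of_mul_le_mul_right (hle.trans hsumTY) hpos
  have : N * ((c : ℝ) / (N + 1)) < c := by
    rw [mul_div_assoc', div_lt_iff₀ (by positivity)]
    linarith
  linarith

end CoarseStructure

theorem mainTheorem3 {X : Type*} (C : CoarseStructure X)
    (hgen : C.CountablyGenerated) (hfin : C.UniformlyLocallyFinite) :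
    ¬ C.PropertyA ↔
      ∃ (E : ℕ → Set X) (hE : Pairwise (Function.onFun Disjoint E)),
        (∀ m, (E m).Finite) ∧
        ∃ w : ℕ → DiscreteMeasure (⋃ m, E m : Set X),
          (C.boxSubspace E hE).IsWeightedWeakExpander (fun m => Subtype.val ⁻¹' E m) w := by
  constructor
  · exact CoarseStructure.exists_isWeightedWeakExpander hgen hfin
  · rintro ⟨E, hE, -, w, hw⟩
    exact CoarseStructure.not_propertyA_of_isWeightedWeakExpander hfin hE hw
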